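/- Consider an $M|M|\infty$ queue that is empty at time $0$: customers arrive according to a Poisson process of rate $\lambda>0$ (the interarrival times, counted from time $0$, are i.i.d. exponential with rate $\lambda$); every customer is served from the moment of arrival; the service times are i.i.d. exponential with mean $\alpha>0$ and independent of the arrivals. Let $\rho=\lambda\alpha$ and assume $\rho\neq 1$. Let $I$ be the length of the idle period that starts at time $0$ (the first time at which the system is not empty), let $B$ be the length of the busy period that follows it (the time from $I$ until the system is next empty), and let $Z=I+B$ be the length of the busy cycle. Then for all $t\ge 0$ $$e^{-\rho}\left(1-\frac{\rho e^{-t/\alpha}-e^{-\lambda t}}{\rho-1}\right)\le P(Z\le t)\le 1-\frac{\rho e^{-t/\alpha}-e^{-\lambda t}}{\rho-1}.$$ -/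

import Mathlib

open MeasureTheory ProbabilityTheory
open scoped ENNReal NNReal

namespace InfiniteServerQueue

variable {Ω : Type*}

/-- The `M|G|∞` queue that is empty at time `0`: the interarrival times `τ 0, τ 1, …` of the
customers are exponential with rate `lam` (that is, the arrivals form a Poisson process of rate
`lam`), the service times `σ 0, σ 1, …` have law `G`, and all these variables are mutually
independent. Every customer is served from the moment of arrival. -/
structure IsMGInfQueue [MeasurableSpace Ω] (P : Measure Ω) (lam : ℝ) (G : Measure ℝ)
    (τ σ : ℕ → Ω → ℝ) : Prop where
  interarrival_law : ∀ n, HasLaw (τ n) (expMeasure lam) P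
  service_law : ∀ n, HasLaw (σ n) G P
  indep : iIndepFun (Sum.elim τ σ) P

/-- The `M|M|∞` queue with arrival rate `lam` and exponential service times of mean `α`. -/
def IsMMInfQueue [MeasurableSpace Ω] (P : Measure Ω) (lam α : ℝ) (τ σ : ℕ → Ω → ℝ) : Prop :=
  IsMGInfQueue P lam (expMeasure (1 / α)) τ σ

/-- The arrival time of customer `n` (customers are numbered from `0`). -/
def arrival (τ : ℕ → Ω → ℝ) (n : ℕ) (ω : Ω) : ℝ := ∑ i ∈ Finset.range (n + 1), τ i ω

/-- The departure time of customer `n`: service starts at once and lasts `σ n`. -/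
def departure (τ σ : ℕ → Ω → ℝ) (n : ℕ) (ω : Ω) : ℝ := arrival τ n ω + σ n ω

/-- The number of customers in the system at time `t`. -/
noncomputable def numberInSystem (τ σ : ℕ → Ω → ℝ) (t : ℝ) (ω : Ω) : ℕ∞ :=
  {n : ℕ | arrival τ n ω ≤ t ∧ t < departure τ σ n ω}.encard

/-- The length `I` of the idle period that starts at time `0`: the first time at which the system
is not empty (`∞` if there is none). -/
noncomputable def idlePeriod (τ σ : ℕ → Ω → ℝ) (ω : Ω) : ℝ≥0∞ :=
  ⨅ (t : ℝ≥0) (_ : numberInSystem τ σ t ω ≠ 0), (t : ℝ≥0∞)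

/-- The length `B` of the busy period that follows the idle period: the smallest `u ≥ 0` such that
the system is empty at time `I + u` (`∞` if there is none). -/
noncomputable def busyPeriod (τ σ : ℕ → Ω → ℝ) (ω : Ω) : ℝ≥0∞ :=
  ⨅ (u : ℝ≥0) (_ : ∃ t : ℝ≥0, (t : ℝ≥0∞) = idlePeriod τ σ ω + u ∧ numberInSystem τ σ t ω = 0),
    (u : ℝ≥0∞)

/-- The length `Z = I + B` of the busy cycle. -/
noncomputable def busyCycle (τ σ : ℕ → Ω → ℝ) (ω : Ω) : ℝ≥0∞ :=
  idlePeriod τ σ ω + busyPeriod τ σ ω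

end InfiniteServerQueue

/-!
Let `τ` and `σ` be the first interarrival and service time and `τ'` the second interarrival time.
The idle period is `τ`, and the first customer leaves only at `τ + σ`; hence `τ + σ ≤ Z`, with
equality as soon as `σ < τ'`. This gives `P(τ + σ ≤ t, σ < τ') ≤ P(Z ≤ t) ≤ P(τ + σ ≤ t)`.
Given `τ` and `τ'`, the events `τ + σ ≤ t` and `σ < τ'` are nested, being two down-sets of values of
`σ`, so they are positively correlated: the left-hand side is at least
`P(σ < τ') P(τ + σ ≤ t)`. Finally, Jensen's inequality gives `P(σ < τ') = E[exp(-λσ)] ≥ exp(-ρ)`.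
-/

open Set

namespace InfiniteServerQueue

section Association

lemma measure_mul_le_measure_inter_of_isLowerSet {γ : Type*} [LinearOrder γ] [MeasurableSpace γ]
    {κ : Measure γ} [IsZeroOrProbabilityMeasure κ] {s t : Set γ}
    (hs : IsLowerSet s) (ht : IsLowerSet t) : κ s * κ t ≤ κ (s ∩ t) := by
  rcases hs.total ht with hst | hts
  · rw [inter_eq_left.2 hst]
    exact mul_le_of_le_one_right' prob_le_one
  · rw [inter_eq_right.2 hts]
    exact mul_le_of_le_one_left' prob_le_one

lemma prod_mul_prod_le_prod_of_isLowerSet {α β γ : Type*} [MeasurableSpace α] [MeasurableSpace β]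
    [LinearOrder γ] [MeasurableSpace γ] {μ : Measure α} {ν : Measure β} {κ : Measure γ}
    [SFinite ν] [IsZeroOrProbabilityMeasure κ] {A : Set (α × γ)} {B : Set (β × γ)}
    (hA : MeasurableSet A) (hB : MeasurableSet B)
    (hA_lower : ∀ x, IsLowerSet (Prod.mk x ⁻¹' A)) (hB_lower : ∀ z, IsLowerSet (Prod.mk z ⁻¹' B)) :
    μ.prod κ A * ν.prod κ B ≤
      (μ.prod ν).prod κ {q | (q.1.1, q.2) ∈ A ∧ (q.1.2, q.2) ∈ B} := by
  have hAB : MeasurableSet {q : (α × β) × γ | (q.1.1, q.2) ∈ A ∧ (q.1.2, q.2) ∈ B} :=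
    (hA.preimage (by fun_prop)).inter (hB.preimage (by fun_prop))
  rw [Measure.prod_apply hA, Measure.prod_apply hB, Measure.prod_apply hAB,
    ← lintegral_prod_mul (measurable_measure_prodMk_left hA).aemeasurable
      (measurable_measure_prodMk_left hB).aemeasurable]
  exact lintegral_mono fun p ↦
    measure_mul_le_measure_inter_of_isLowerSet (hA_lower p.1) (hB_lower p.2)

end Association

section Exponential

lemma expMeasure_eq_withDensity (r : ℝ) :
    expMeasure r =
      (volume.restrict (Ioi 0)).withDensity fun x ↦ ENNReal.ofReal (r * Real.exp (-(r * x))) := by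
  have hpdf : exponentialPDF r =
      (Ici 0).indicator fun x ↦ ENNReal.ofReal (r * Real.exp (-(r * x))) := by
    ext x
    by_cases hx : 0 ≤ x <;> simp [exponentialPDF_eq, hx]
  rw [Measure.restrict_congr_set Ioi_ae_eq_Ici, ← withDensity_indicator measurableSet_Ici, ← hpdf]
  rfl

lemma ae_pos_expMeasure (r : ℝ) : ∀ᵐ x ∂expMeasure r, 0 < x := by
  rw [expMeasure_eq_withDensity]
  exact (withDensity_absolutelyContinuous _ _).ae_le (ae_restrict_mem measurableSet_Ioi)

lemma integral_expMeasure {r : ℝ} (hr : 0 ≤ r) (f : ℝ → ℝ) :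
    ∫ x, f x ∂expMeasure r = ∫ x in Ioi 0, r * Real.exp (-(r * x)) * f x := by
  rw [expMeasure_eq_withDensity, integral_withDensity_eq_integral_toReal_smul (by fun_prop)
    (.of_forall fun _ ↦ ENNReal.ofReal_lt_top)]
  refine integral_congr_ae (.of_forall fun x ↦ ?_)
  simp only [smul_eq_mul]
  rw [ENNReal.toReal_ofReal (by positivity)]

lemma integral_id_expMeasure {r : ℝ} (hr : 0 < r) : ∫ x, x ∂expMeasure r = 1 / r := by
  have h := Real.integral_rpow_mul_exp_neg_mul_Ioi (a := 2) two_pos hr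
  simp only [show (2 : ℝ) - 1 = 1 by norm_num, Real.rpow_one, Real.rpow_two, Real.Gamma_two,
    mul_one] at h
  have hcomm (x : ℝ) : r * Real.exp (-(r * x)) * x = r * (x * Real.exp (-(r * x))) := by ring
  rw [integral_expMeasure hr.le]
  simp only [hcomm]
  rw [integral_const_mul, h]
  field_simp

lemma integrable_id_expMeasure {r : ℝ} (hr : 0 < r) : Integrable (fun x ↦ x) (expMeasure r) := by
  refine .of_integral_ne_zero ?_
  rw [integral_id_expMeasure hr]
  positivity

lemma measureReal_expMeasure_Iic {r : ℝ} (hr : 0 < r) (x : ℝ) :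
    (expMeasure r).real (Iic x) = if 0 ≤ x then 1 - Real.exp (-(r * x)) else 0 := by
  have := isProbabilityMeasure_expMeasure hr
  rw [← cdf_eq_real, cdf_expMeasure_eq hr]

lemma expMeasure_Ioi {r x : ℝ} (hr : 0 < r) (hx : 0 ≤ x) :
    expMeasure r (Ioi x) = ENNReal.ofReal (Real.exp (-(r * x))) := by
  have := isProbabilityMeasure_expMeasure hr
  rw [← ofReal_measureReal, ← compl_Iic, probReal_compl_eq_one_sub measurableSet_Iic,
    measureReal_expMeasure_Iic hr, if_pos hx, sub_sub_cancel]

lemma exp_neg_mul_integral_le_prod_expMeasure_lt {a : ℝ} (ha : 0 < a) {G : Measure ℝ}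
    [IsProbabilityMeasure G] (hG_nonneg : ∀ᵐ y ∂G, 0 ≤ y) (hG : Integrable (fun y ↦ y) G) :
    ENNReal.ofReal (Real.exp (-(a * ∫ y, y ∂G))) ≤
      ((expMeasure a).prod G) {p | p.2 < p.1} := by
  have := isProbabilityMeasure_expMeasure ha
  have hexp : Integrable (fun y ↦ Real.exp (-(a * y))) G := by
    refine .of_bound (by fun_prop) 1 ?_
    filter_upwards [hG_nonneg] with y hy
    rw [Real.norm_eq_abs, Real.abs_exp, Real.exp_le_one_iff]
    nlinarith
  have jensen : Real.exp (-(a * ∫ y, y ∂G)) ≤ ∫ y, Real.exp (-(a * y)) ∂G := by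
    rw [← integral_const_mul, ← integral_neg]
    exact convexOn_exp.map_integral_le Real.continuous_exp.continuousOn isClosed_univ
      (.of_forall fun _ ↦ mem_univ _) (hG.const_mul a).neg hexp
  calc ENNReal.ofReal (Real.exp (-(a * ∫ y, y ∂G)))
      ≤ ENNReal.ofReal (∫ y, Real.exp (-(a * y)) ∂G) := ENNReal.ofReal_le_ofReal jensen
    _ = ∫⁻ y, ENNReal.ofReal (Real.exp (-(a * y))) ∂G :=
        ofReal_integral_eq_lintegral_ofReal hexp (.of_forall fun _ ↦ (Real.exp_pos _).le)
    _ = ∫⁻ y, expMeasure a (Ioi y) ∂G := by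
        refine lintegral_congr_ae ?_
        filter_upwards [hG_nonneg] with y hy using (expMeasure_Ioi ha hy).symm
    _ = ((expMeasure a).prod G) {p | p.2 < p.1} :=
        (Measure.prod_apply_symm (measurableSet_lt measurable_snd measurable_fst)).symm

end Exponential

section Convolution

lemma conv_Iic_eq_prod (μ ν : Measure ℝ) (t : ℝ) :
    (μ ∗ ν) (Iic t) = μ.prod ν {p | p.1 + p.2 ≤ t} :=
  Measure.map_apply measurable_add measurableSet_Iic

lemma measureReal_conv_Iic (μ ν : Measure ℝ) [IsFiniteMeasure ν] (t : ℝ) :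
    (μ ∗ ν).real (Iic t) = ∫ x, ν.real (Iic (t - x)) ∂μ := by
  have hs : MeasurableSet {p : ℝ × ℝ | p.1 + p.2 ≤ t} :=
    measurableSet_le (by fun_prop) (by fun_prop)
  have hsec (x : ℝ) : Prod.mk x ⁻¹' {p : ℝ × ℝ | p.1 + p.2 ≤ t} = Iic (t - x) := by
    ext y
    simp [le_sub_iff_add_le']
  have hmeas := measurable_measure_prodMk_left (ν := ν) hs
  simp only [hsec] at hmeas
  rw [measureReal_def, conv_Iic_eq_prod, Measure.prod_apply hs]
  simp only [hsec]
  exact (integral_toReal hmeas.aemeasurable (.of_forall fun _ ↦ measure_lt_top _ _)).symm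

lemma integral_exp_mul_one_sub_exp {a b : ℝ} (hab : a ≠ b) (t : ℝ) :
    ∫ x in (0 : ℝ)..t, a * Real.exp (-(a * x)) * (1 - Real.exp (-(b * (t - x)))) =
      1 - (a * Real.exp (-(b * t)) - b * Real.exp (-(a * t))) / (a - b) := by
  have hne : a - b ≠ 0 := sub_ne_zero.2 hab
  have hsplit (x : ℝ) : Real.exp (-(a * x)) * Real.exp (-(b * (t - x))) =
      Real.exp (-(b * t)) * Real.exp (-((a - b) * x)) := by
    rw [← Real.exp_add, ← Real.exp_add]
    ring_nf
  have hderiv (x : ℝ) : HasDerivAt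
      (fun x ↦ -Real.exp (-(a * x)) -
        a / (a - b) * Real.exp (-(b * t)) * -Real.exp (-((a - b) * x)))
      (a * Real.exp (-(a * x)) * (1 - Real.exp (-(b * (t - x))))) x := by
    refine (hasDerivAt_neg_exp_mul_exp.sub
      (hasDerivAt_neg_exp_mul_exp.const_mul _)).congr_deriv ?_
    rw [mul_one_sub, mul_assoc, mul_assoc a, hsplit]
    field_simp
  rw [intervalIntegral.integral_eq_sub_of_hasDerivAt (fun x _ ↦ hderiv x)
    (Continuous.intervalIntegrable (by fun_prop) _ _)]
  have hexp : Real.exp (-(b * t)) * Real.exp (-((a - b) * t)) = Real.exp (-(a * t)) := by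
    rw [← hsplit, sub_self, mul_zero, neg_zero, Real.exp_zero, mul_one]
  simp only [mul_zero, neg_zero, Real.exp_zero]
  rw [mul_neg, mul_assoc, hexp]
  field_simp
  ring

lemma measureReal_conv_expMeasure_Iic {a b t : ℝ} (ha : 0 < a) (hb : 0 < b) (hab : a ≠ b)
    (ht : 0 ≤ t) :
    (expMeasure a ∗ expMeasure b).real (Iic t) =
      1 - (a * Real.exp (-(b * t)) - b * Real.exp (-(a * t))) / (a - b) := by
  have := isProbabilityMeasure_expMeasure ha
  have := isProbabilityMeasure_expMeasure hb
  have hcdf (x : ℝ) : a * Real.exp (-(a * x)) * (expMeasure b).real (Iic (t - x)) =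
      (Iic t).indicator
        (fun x ↦ a * Real.exp (-(a * x)) * (1 - Real.exp (-(b * (t - x))))) x := by
    by_cases hx : x ≤ t <;> simp [measureReal_expMeasure_Iic hb, hx]
  rw [measureReal_conv_Iic, integral_expMeasure ha.le]
  simp only [hcdf]
  rw [setIntegral_indicator measurableSet_Iic, Ioi_inter_Iic, ← intervalIntegral.integral_of_le ht,
    integral_exp_mul_one_sub_exp hab]

lemma measureReal_conv_expMeasure_one_div_Iic {lam α t : ℝ} (hlam : 0 < lam) (hα : 0 < α)
    (hρ : lam * α ≠ 1) (ht : 0 ≤ t) :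
    (expMeasure lam ∗ expMeasure (1 / α)).real (Iic t) =
      1 - (lam * α * Real.exp (-t / α) - Real.exp (-lam * t)) / (lam * α - 1) := by
  have hne : lam ≠ 1 / α := fun h ↦ hρ (by rw [h, one_div_mul_cancel hα.ne'])
  have hne' : lam * α - 1 ≠ 0 := sub_ne_zero.2 hρ
  have hsub : lam - 1 / α = (lam * α - 1) / α := by field_simp
  rw [measureReal_conv_expMeasure_Iic hlam (by positivity) hne ht, hsub,
    show -(1 / α * t) = -t / α by ring, neg_mul]
  field_simp

end Convolution

section SamplePath

variable {Ω : Type*} {τ σ : ℕ → Ω → ℝ} {ω : Ω}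

lemma monotone_arrival (hτ : ∀ n, 0 ≤ τ n ω) : Monotone fun n ↦ arrival τ n ω :=
  monotone_nat_of_le_succ fun n ↦ by
    rw [arrival, arrival, Finset.sum_range_succ _ (n + 1)]
    exact le_add_of_nonneg_right (hτ (n + 1))

lemma arrival_zero : arrival τ 0 ω = τ 0 ω := by simp [arrival]

lemma arrival_one : arrival τ 1 ω = τ 0 ω + τ 1 ω := by simp [arrival, Finset.sum_range_succ]

lemma departure_zero : departure τ σ 0 ω = τ 0 ω + σ 0 ω := by rw [departure, arrival_zero]

lemma numberInSystem_eq_zero_iff {t : ℝ} :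
    numberInSystem τ σ t ω = 0 ↔ ∀ n, arrival τ n ω ≤ t → departure τ σ n ω ≤ t := by
  simp [numberInSystem, eq_empty_iff_forall_notMem]

lemma numberInSystem_eq_zero_of_lt_first_arrival (hτ : ∀ n, 0 ≤ τ n ω) {t : ℝ} (ht : t < τ 0 ω) :
    numberInSystem τ σ t ω = 0 := by
  refine numberInSystem_eq_zero_iff.2 fun n hn ↦ absurd (hn.trans_lt ht) (not_lt.2 ?_)
  simpa only [arrival_zero] using monotone_arrival hτ n.zero_le

lemma numberInSystem_ne_zero_of_first_in_service {t : ℝ} (h0 : τ 0 ω ≤ t)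
    (h1 : t < τ 0 ω + σ 0 ω) : numberInSystem τ σ t ω ≠ 0 := by
  intro h
  have := numberInSystem_eq_zero_iff.1 h 0 (by rwa [arrival_zero])
  rw [departure_zero] at this
  exact this.not_gt h1

lemma numberInSystem_first_departure_eq_zero (hτ : ∀ n, 0 ≤ τ n ω) (h : σ 0 ω < τ 1 ω) :
    numberInSystem τ σ (τ 0 ω + σ 0 ω) ω = 0 := by
  refine numberInSystem_eq_zero_iff.2 fun n hn ↦ ?_
  cases n with
  | zero => exact departure_zero.le
  | succ n =>
    have hmono : arrival τ 1 ω ≤ arrival τ (n + 1) ω := monotone_arrival hτ (Nat.le_add_left 1 n)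
    rw [arrival_one] at hmono
    linarith

lemma idlePeriod_eq (hτ : ∀ n, 0 ≤ τ n ω) (hσ : 0 < σ 0 ω) :
    idlePeriod τ σ ω = ENNReal.ofReal (τ 0 ω) := by
  apply le_antisymm
  · refine iInf₂_le (τ 0 ω).toNNReal ?_
    rw [Real.coe_toNNReal _ (hτ 0)]
    exact numberInSystem_ne_zero_of_first_in_service le_rfl (lt_add_of_pos_right _ hσ)
  · refine le_iInf₂ fun t ht ↦ ?_
    contrapose! ht
    exact numberInSystem_eq_zero_of_lt_first_arrival hτ
      ((ENNReal.ofReal_lt_ofReal_iff').1 (by rwa [ENNReal.ofReal_coe_nnreal])).1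

lemma ofReal_le_busyPeriod (hτ : ∀ n, 0 ≤ τ n ω) (hσ : 0 < σ 0 ω) :
    ENNReal.ofReal (σ 0 ω) ≤ busyPeriod τ σ ω := by
  refine le_iInf₂ fun u ⟨t, htu, ht⟩ ↦ ?_
  have htu' : (t : ℝ) = τ 0 ω + u := by
    rw [idlePeriod_eq hτ hσ] at htu
    simpa [ENNReal.toReal_add, hτ 0] using congrArg ENNReal.toReal htu
  contrapose! ht
  have hu : (u : ℝ) < σ 0 ω := (ENNReal.lt_ofReal_iff_toReal_lt ENNReal.coe_ne_top).1 ht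
  rw [htu']
  exact numberInSystem_ne_zero_of_first_in_service (le_add_of_nonneg_right u.coe_nonneg)
    (by gcongr)

lemma busyPeriod_le_of_lt (hτ : ∀ n, 0 ≤ τ n ω) (hσ : 0 < σ 0 ω) (h : σ 0 ω < τ 1 ω) :
    busyPeriod τ σ ω ≤ ENNReal.ofReal (σ 0 ω) := by
  refine iInf₂_le (σ 0 ω).toNNReal ⟨(τ 0 ω + σ 0 ω).toNNReal, ?_, ?_⟩
  · rw [idlePeriod_eq hτ hσ]
    exact ENNReal.ofReal_add (hτ 0) hσ.le
  · rw [Real.coe_toNNReal _ (add_nonneg (hτ 0) hσ.le)]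
    exact numberInSystem_first_departure_eq_zero hτ h

lemma ofReal_add_le_busyCycle (hτ : ∀ n, 0 ≤ τ n ω) (hσ : 0 < σ 0 ω) :
    ENNReal.ofReal (τ 0 ω + σ 0 ω) ≤ busyCycle τ σ ω := by
  rw [busyCycle, idlePeriod_eq hτ hσ, ENNReal.ofReal_add (hτ 0) hσ.le]
  gcongr
  exact ofReal_le_busyPeriod hτ hσ

lemma busyCycle_le_of_lt (hτ : ∀ n, 0 ≤ τ n ω) (hσ : 0 < σ 0 ω) (h : σ 0 ω < τ 1 ω) :
    busyCycle τ σ ω ≤ ENNReal.ofReal (τ 0 ω + σ 0 ω) := by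
  rw [busyCycle, idlePeriod_eq hτ hσ, ENNReal.ofReal_add (hτ 0) hσ.le]
  gcongr
  exact busyPeriod_le_of_lt hτ hσ h

end SamplePath

namespace IsMGInfQueue

variable {Ω : Type*} [MeasurableSpace Ω] {P : Measure Ω} {lam : ℝ} {G : Measure ℝ}
  {τ σ : ℕ → Ω → ℝ}

lemma ae_nonneg_interarrival (hQ : IsMGInfQueue P lam G τ σ) : ∀ᵐ ω ∂P, ∀ n, 0 ≤ τ n ω :=
  ae_all_iff.2 fun n ↦ ((hQ.interarrival_law n).ae_iff (p := fun x ↦ 0 ≤ x)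
    (measurableSet_setOfPred.1 measurableSet_Ici)).2
      ((ae_pos_expMeasure lam).mono fun _ hx ↦ hx.le)

lemma ae_pos_service (hQ : IsMGInfQueue P lam G τ σ) (hG_pos : ∀ᵐ y ∂G, 0 < y) (n : ℕ) :
    ∀ᵐ ω ∂P, 0 < σ n ω :=
  ((hQ.service_law n).ae_iff (p := fun x ↦ 0 < x)
    (measurableSet_setOfPred.1 measurableSet_Ioi)).2 hG_pos

variable [IsProbabilityMeasure P]

lemma isProbabilityMeasure_service (hQ : IsMGInfQueue P lam G τ σ) : IsProbabilityMeasure G :=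
  (hQ.service_law 0).isProbabilityMeasure_iff.1 inferInstance

lemma isProbabilityMeasure_interarrival (hQ : IsMGInfQueue P lam G τ σ) :
    IsProbabilityMeasure (expMeasure lam) :=
  (hQ.interarrival_law 0).isProbabilityMeasure_iff.1 inferInstance

lemma hasLaw_first_departure (hQ : IsMGInfQueue P lam G τ σ) :
    HasLaw (fun ω ↦ τ 0 ω + σ 0 ω) (expMeasure lam ∗ G) P := by
  have := hQ.isProbabilityMeasure_service
  have := hQ.isProbabilityMeasure_interarrival
  have hind : IndepFun (τ 0) (σ 0) P :=
    hQ.indep.indepFun (i := Sum.inl 0) (j := Sum.inr 0) Sum.inl_ne_inr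
  exact hind.hasLaw_fun_add (hQ.interarrival_law 0) (hQ.service_law 0)

lemma hasLaw_interarrival_interarrival_service (hQ : IsMGInfQueue P lam G τ σ) :
    HasLaw (fun ω ↦ ((τ 0 ω, τ 1 ω), σ 0 ω))
      (((expMeasure lam).prod (expMeasure lam)).prod G) P := by
  have := hQ.isProbabilityMeasure_service
  have := hQ.isProbabilityMeasure_interarrival
  have hmeas : ∀ i, AEMeasurable (Sum.elim τ σ i) P := by
    rintro (i | i)
    · exact (hQ.interarrival_law i).aemeasurable
    · exact (hQ.service_law i).aemeasurable
  have hττ : IndepFun (τ 0) (τ 1) P :=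
    hQ.indep.indepFun (i := Sum.inl 0) (j := Sum.inl 1) (by simp)
  have hττσ : IndepFun (fun ω ↦ (τ 0 ω, τ 1 ω)) (σ 0) P :=
    hQ.indep.indepFun_prodMk₀ hmeas (Sum.inl 0) (Sum.inl 1) (Sum.inr 0) (by simp) (by simp)
  exact (indepFun_iff_hasLaw_prodMk_prod ((indepFun_iff_hasLaw_prodMk_prod
    (hQ.interarrival_law 0) (hQ.interarrival_law 1)).1 hττ) (hQ.service_law 0)).1 hττσ

lemma measure_busyCycle_le_le (hQ : IsMGInfQueue P lam G τ σ) (hG_pos : ∀ᵐ y ∂G, 0 < y) (t : ℝ) :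
    P {ω | busyCycle τ σ ω ≤ ENNReal.ofReal t} ≤ (expMeasure lam ∗ G) (Iic t) := by
  refine le_of_le_of_eq (measure_mono_ae ?_)
    (hQ.hasLaw_first_departure.measure_eq measurableSet_Iic)
  filter_upwards [hQ.ae_nonneg_interarrival, hQ.ae_pos_service hG_pos 0] with ω hτ hσ hZ
  have hpos : 0 < τ 0 ω + σ 0 ω := add_pos_of_nonneg_of_pos (hτ 0) hσ
  have hle : ENNReal.ofReal (τ 0 ω + σ 0 ω) ≤ ENNReal.ofReal t :=
    (ofReal_add_le_busyCycle hτ hσ).trans hZ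
  exact (ENNReal.ofReal_le_ofReal_iff'.1 hle).resolve_right hpos.not_ge

lemma prod_lt_mul_conv_Iic_le_measure_busyCycle_le (hQ : IsMGInfQueue P lam G τ σ)
    (hG_pos : ∀ᵐ y ∂G, 0 < y) (t : ℝ) :
    (expMeasure lam).prod G {p | p.2 < p.1} * (expMeasure lam ∗ G) (Iic t) ≤
      P {ω | busyCycle τ σ ω ≤ ENNReal.ofReal t} := by
  have := hQ.isProbabilityMeasure_service
  have := hQ.isProbabilityMeasure_interarrival
  have hdep : MeasurableSet {p : ℝ × ℝ | p.1 + p.2 ≤ t} :=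
    measurableSet_le (by fun_prop) (by fun_prop)
  have hlt : MeasurableSet {p : ℝ × ℝ | p.2 < p.1} := measurableSet_lt measurable_snd measurable_fst
  have hdep_lower (x : ℝ) : IsLowerSet (Prod.mk x ⁻¹' {p : ℝ × ℝ | p.1 + p.2 ≤ t}) :=
    fun y y' hy (h : x + y ≤ t) ↦ (add_le_add_right hy x).trans h
  have hlt_lower (z : ℝ) : IsLowerSet (Prod.mk z ⁻¹' {p : ℝ × ℝ | p.2 < p.1}) :=
    fun y y' hy (h : y < z) ↦ hy.trans_lt h
  calc (expMeasure lam).prod G {p | p.2 < p.1} * (expMeasure lam ∗ G) (Iic t)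
      ≤ ((expMeasure lam).prod (expMeasure lam)).prod G
          {q | q.1.1 + q.2 ≤ t ∧ q.2 < q.1.2} := by
        rw [mul_comm, conv_Iic_eq_prod]
        exact prod_mul_prod_le_prod_of_isLowerSet hdep hlt hdep_lower hlt_lower
    _ = P {ω | τ 0 ω + σ 0 ω ≤ t ∧ σ 0 ω < τ 1 ω} :=
        (hQ.hasLaw_interarrival_interarrival_service.measure_eq
          (p := fun q ↦ q.1.1 + q.2 ≤ t ∧ q.2 < q.1.2)
          ((hdep.preimage (f := fun q : (ℝ × ℝ) × ℝ ↦ (q.1.1, q.2)) (by fun_prop)).inter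
            (hlt.preimage (f := fun q : (ℝ × ℝ) × ℝ ↦ (q.1.2, q.2)) (by fun_prop)))).symm
    _ ≤ P {ω | busyCycle τ σ ω ≤ ENNReal.ofReal t} := by
        refine measure_mono_ae ?_
        filter_upwards [hQ.ae_nonneg_interarrival, hQ.ae_pos_service hG_pos 0] with ω hτ hσ hcycle
        exact (busyCycle_le_of_lt hτ hσ hcycle.2).trans (ENNReal.ofReal_le_ofReal hcycle.1)

end IsMGInfQueue

end InfiniteServerQueue

theorem mainTheorem4_general {Ω : Type*} [MeasurableSpace Ω] {P : Measure Ω}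
    [IsProbabilityMeasure P] {lam : ℝ} (hlam : 0 < lam) {G : Measure ℝ}
    (hG_pos : ∀ᵐ y ∂G, 0 < y) (hG : Integrable (fun y ↦ y) G) {τ σ : ℕ → Ω → ℝ}
    (hQ : InfiniteServerQueue.IsMGInfQueue P lam G τ σ) (t : ℝ) :
    Real.exp (-(lam * ∫ y, y ∂G)) * (expMeasure lam ∗ G).real (Iic t) ≤
        P.real {ω | InfiniteServerQueue.busyCycle τ σ ω ≤ ENNReal.ofReal t} ∧
      P.real {ω | InfiniteServerQueue.busyCycle τ σ ω ≤ ENNReal.ofReal t} ≤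
        (expMeasure lam ∗ G).real (Iic t) := by
  have := hQ.isProbabilityMeasure_service
  have := hQ.isProbabilityMeasure_interarrival
  refine ⟨?_, ENNReal.toReal_mono (measure_ne_top _ _) (hQ.measure_busyCycle_le_le hG_pos t)⟩
  have no_arrival_during_service : Real.exp (-(lam * ∫ y, y ∂G)) ≤
      ((expMeasure lam).prod G).real {p | p.2 < p.1} :=
    (ENNReal.ofReal_le_iff_le_toReal (measure_ne_top _ _)).1 <|
      InfiniteServerQueue.exp_neg_mul_integral_le_prod_expMeasure_lt hlam
        (hG_pos.mono fun _ ↦ le_of_lt) hG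
  calc Real.exp (-(lam * ∫ y, y ∂G)) * (expMeasure lam ∗ G).real (Iic t)
      ≤ ((expMeasure lam).prod G).real {p | p.2 < p.1} * (expMeasure lam ∗ G).real (Iic t) := by
        gcongr
    _ ≤ P.real {ω | InfiniteServerQueue.busyCycle τ σ ω ≤ ENNReal.ofReal t} := by
        simpa only [measureReal_def, ENNReal.toReal_mul] using ENNReal.toReal_mono
          (measure_ne_top P _) (hQ.prod_lt_mul_conv_Iic_le_measure_busyCycle_le hG_pos t)

theorem mainTheorem4 {Ω : Type*} [MeasurableSpace Ω] (P : Measure Ω) [IsProbabilityMeasure P]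
    (lam α ρ : ℝ) (hlam : 0 < lam) (hα : 0 < α) (hρ : ρ = lam * α) (hρ1 : ρ ≠ 1)
    (τ σ : ℕ → Ω → ℝ) (hQ : InfiniteServerQueue.IsMMInfQueue P lam α τ σ)
    (t : ℝ) (ht : 0 ≤ t) :
    Real.exp (-ρ) * (1 - (ρ * Real.exp (-t / α) - Real.exp (-lam * t)) / (ρ - 1)) ≤
        P.real {ω | InfiniteServerQueue.busyCycle τ σ ω ≤ ENNReal.ofReal t} ∧
      P.real {ω | InfiniteServerQueue.busyCycle τ σ ω ≤ ENNReal.ofReal t} ≤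
        1 - (ρ * Real.exp (-t / α) - Real.exp (-lam * t)) / (ρ - 1) := by
  subst hρ
  simpa only [InfiniteServerQueue.integral_id_expMeasure (one_div_pos.2 hα), one_div_one_div,
    InfiniteServerQueue.measureReal_conv_expMeasure_one_div_Iic hlam hα hρ1 ht] using
    mainTheorem4_general hlam (InfiniteServerQueue.ae_pos_expMeasure (1 / α))
      (InfiniteServerQueue.integrable_id_expMeasure (one_div_pos.2 hα)) hQ t
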